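/- Consider the instrumental causal structure: a directed acyclic graph with observed nodes $X,Y,Z$, one unobserved node $A$, and edges $X\to Z$, $Z\to Y$, $A\to Z$, $A\to Y$. The observed nodes carry random variables with finitely many values; the unobserved node carries a bipartite resource with subsystems $A_Z$ and $A_Y$, sent to $Z$ and $Y$ respectively. A joint distribution $P$ of $(X,Y,Z)$ is compatible with the structure if, for some probability distribution $p$ of $X$, one of the following holds. * Classical resource: $P(x,y,z)=p(x)\sum_{a,b}q(a,b)\,r(z|x,a)\,t(y|z,b)$, where $q$ is a probability distribution on a finite product set and $r$, $t$ are conditional probability distributions. * Quantum resource: $P(x,y,z)=p(x)\,\mathrm{tr}\big[\rho\,(E_x^z\otimes F_z^y)\big]$, where $\rho$ is a density operator on a tensor product of two finite-dimensional Hilbert spaces, and, for each $x$ and each $z$, $\{E_x^{z'}\}_{z'}$ and $\{F_z^y\}_y$ are POVMs on the first and the second factor respectively. * Resource from a generalised probabilistic theory (GPT) $G$: $P(x,y,z)=p(x)\,(e_x^z\otimes f_z^y)(s)$, where $s$ is a state of the joint system $A_ZA_Y$ of two systems of $G$, and, for each $x$ and each $z$, $\{e_x^{z'}\}_{z'}$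 and $\{f_z^y\}_y$ are allowed measurements on $A_Z$ and $A_Y$ respectively. Here a GPT assigns to each system $A$ a nonempty compact convex state space $\mathcal S_A$ in a real (Hausdorff topological) vector space, a set of effects (linear functionals with values in $[0,1]$ on $\mathcal S_A$) containing a unit effect $u_A$ (equal to $1$ on $\mathcal S_A$), and a set of allowed measurements (finite families of effects summing to $u_A$) closed under relabelling and coarse-graining. Transformations map states to states, include the identities, are closed under composition, and a transformation followed by a measurement is a measurement. Any two systems $A,B$ have a joint system $AB$ with bilinear products $s\otimes t$ of states and $e\otimes f$ of effects such that products of states are states, products of measurements are measurements, $(e\otimes f)(s\otimes t)=e(s)f(t)$, and reduced states exist: for every $s\in\mathcal S_{AB}$ there is $s_A\in\mathcal S_A$ with $e(s_A)=(e\otimes u_B)(s)$ for all effects $e$ on $A$, and likewise for $B$. Local tomography is not assumed. Finally, classical systems can be represented in every GPT: for each $n\ge1$ some system has $n$ states that are perfectly distinguished by an allowed measurement. The entropy vector of $P$ is $(H(X),H(Y),H(Z),H(XY),H(XZ),H(YZ),H(XYZ))\in\mathbb R^7$, where $H$ is the Shannon entropy in bits. Let $\Gamma\subset\mathbb R^7$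 be the polyhedral cone of all vectors $h$ that, with $h(\emptyset)=0$, satisfy the Shannon inequalities, for all $S,T,U\subseteq\{X,Y,Z\}$, $$h(S)\ge 0,\qquad h(S\cup T)-h(T)\ge 0,\qquad h(S\cup T\cup U)+h(U)\le h(S\cup U)+h(T\cup U),$$ together with $$I(X:YZ)=h(X)+h(YZ)-h(XYZ)\le h(Z).$$ Then the closure of the set of entropy vectors of compatible distributions is exactly $\Gamma$ when the resource is classical, also when it is quantum, and also, for every GPT $G$, when it is from $G$. -/

import Mathlib

open scoped Kronecker ComplexOrder

universe u v

/-! ### Generalised probabilistic theories -/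

open Classical in
/-- A generalised probabilistic theory. `IsMeas A e` says that the finite family of effects `e`
is one of the allowed measurements on `A`. The joint system `comp A B` is not required to be
locally tomographic: `V (comp A B)` need not be spanned by product vectors. -/
structure GPT where
  /-- the systems of the theory -/
  Sys : Type u
  /-- the real (topological) vector space in which the states of a system live -/
  V : Sys → Type v
  [addCommGroup : ∀ A, AddCommGroup (V A)]
  [module : ∀ A, Module ℝ (V A)]
  [topologicalSpace : ∀ A, TopologicalSpace (V A)]
  [isTopologicalAddGroup : ∀ A, IsTopologicalAddGroup (V A)]
  [continuousSMul : ∀ A, ContinuousSMul ℝ (V A)]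
  [t2Space : ∀ A, T2Space (V A)]
  /-- state spaces -/
  state : ∀ A, Set (V A)
  state_nonempty : ∀ A, (state A).Nonempty
  state_convex : ∀ A, Convex ℝ (state A)
  state_compact : ∀ A, IsCompact (state A)
  /-- effects: linear functionals with values in `[0,1]` on the states -/
  effect : ∀ A, Set (Module.Dual ℝ (V A))
  effect_mem : ∀ A, ∀ e ∈ effect A, ∀ s ∈ state A, e s ∈ Set.Icc (0 : ℝ) 1
  /-- the unit effect -/
  unit : ∀ A, Module.Dual ℝ (V A)
  unit_effect : ∀ A, unit A ∈ effect A
  unit_state : ∀ A, ∀ s ∈ state A, unit A s = 1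
  /-- allowed measurements, with a finite set `ι` of outcomes -/
  IsMeas : ∀ (A : Sys) {ι : Type} [Fintype ι], (ι → Module.Dual ℝ (V A)) → Prop
  meas_effect : ∀ (A : Sys) {ι : Type} [Fintype ι] (e : ι → Module.Dual ℝ (V A)),
    IsMeas A e → ∀ i, e i ∈ effect A
  meas_sum : ∀ (A : Sys) {ι : Type} [Fintype ι] (e : ι → Module.Dual ℝ (V A)),
    IsMeas A e → ∑ i, e i = unit A
  /-- closure under relabelling and coarse-graining of the outcomes -/
  meas_coarse : ∀ (A : Sys) {ι κ : Type} [Fintype ι] [Fintype κ]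
    (e : ι → Module.Dual ℝ (V A)) (F : ι → κ), IsMeas A e →
      IsMeas A (fun k => ∑ i ∈ Finset.univ.filter (fun i => F i = k), e i)
  /-- transformations between systems -/
  trans : ∀ A B, Set (V A →ₗ[ℝ] V B)
  trans_id : ∀ A, LinearMap.id ∈ trans A A
  trans_comp : ∀ A B C, ∀ T ∈ trans A B, ∀ T' ∈ trans B C, T' ∘ₗ T ∈ trans A C
  trans_state : ∀ A B, ∀ T ∈ trans A B, ∀ s ∈ state A, T s ∈ state B
  trans_meas : ∀ (A B : Sys), ∀ T ∈ trans A B, ∀ {ι : Type} [Fintype ι]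
    (e : ι → Module.Dual ℝ (V B)), IsMeas B e → IsMeas A (fun i => e i ∘ₗ T)
  /-- the joint system of two systems -/
  comp : Sys → Sys → Sys
  /-- `s ⊗ t` -/
  tens : ∀ A B, V A →ₗ[ℝ] V B →ₗ[ℝ] V (comp A B)
  /-- `e ⊗ f` -/
  effTens : ∀ A B, Module.Dual ℝ (V A) →ₗ[ℝ] Module.Dual ℝ (V B) →ₗ[ℝ]
    Module.Dual ℝ (V (comp A B))
  tens_state : ∀ A B, ∀ s ∈ state A, ∀ t ∈ state B, tens A B s t ∈ state (comp A B)
  tens_meas : ∀ (A B : Sys) {ι κ : Type} [Fintype ι] [Fintype κ]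
    (e : ι → Module.Dual ℝ (V A)) (f : κ → Module.Dual ℝ (V B)), IsMeas A e → IsMeas B f →
      IsMeas (comp A B) (fun x : ι × κ => effTens A B (e x.1) (f x.2))
  effTens_tens : ∀ A B, ∀ e ∈ effect A, ∀ f ∈ effect B, ∀ s ∈ state A, ∀ t ∈ state B,
    effTens A B e f (tens A B s t) = e s * f t
  /-- reduced states -/
  reduced_left : ∀ A B, ∀ s ∈ state (comp A B), ∃ t ∈ state A, ∀ e ∈ effect A,
    e t = effTens A B e (unit B) s
  reduced_right : ∀ A B, ∀ s ∈ state (comp A B), ∃ t ∈ state B, ∀ f ∈ effect B,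
    f t = effTens A B (unit A) f s
  /-- A classical system with any number `n ≥ 1` of values can be represented in the theory:
  some system has `n` states that an allowed measurement distinguishes perfectly. -/
  classical : ∀ n : ℕ, 0 < n → ∃ (A : Sys) (s : Fin n → V A) (e : Fin n → Module.Dual ℝ (V A)),
    (∀ i, s i ∈ state A) ∧ IsMeas A e ∧ ∀ i j, e i (s j) = if i = j then 1 else 0

attribute [instance] GPT.addCommGroup GPT.module GPT.topologicalSpace
  GPT.isTopologicalAddGroup GPT.continuousSMul GPT.t2Space

/-! ### Observed variables and their entropies -/

/-- The observed nodes of the instrumental causal structure `X → Z → Y`, `A → Z`, `A → Y`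
(with `A` unobserved). -/
inductive Obs where
  | X | Y | Z
  deriving DecidableEq

instance : Fintype Obs := ⟨{Obs.X, Obs.Y, Obs.Z}, fun o => by cases o <;> decide⟩

/-- Vectors with one component for each nonempty set of observed nodes. -/
abbrev EntropyVector : Type := {S : Finset Obs // S.Nonempty} → ℝ

open Classical in
/-- The marginal of the joint distribution `P` on the variables in `S`. -/
noncomputable def marginal {α : Obs → Type} [∀ o, Fintype (α o)] (P : (∀ o, α o) → ℝ)
    (S : Finset Obs) (w : ∀ o : S, α o) : ℝ :=
  ∑ x ∈ Finset.univ.filter (fun x : ∀ o, α o => ∀ o : S, x o = w o), P x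

/-- The Shannon entropy, in bits, of the variables in `S` under the joint distribution `P`. -/
noncomputable def shannonEntropy {α : Obs → Type} [∀ o, Fintype (α o)] (P : (∀ o, α o) → ℝ)
    (S : Finset Obs) : ℝ :=
  -∑ w : (∀ o : S, α o), marginal P S w * Real.logb 2 (marginal P S w)

/-- `(H(X), H(Y), H(Z), H(XY), H(XZ), H(YZ), H(XYZ))` for the joint distribution `P`. -/
noncomputable def entropyVector {α : Obs → Type} [∀ o, Fintype (α o)] (P : (∀ o, α o) → ℝ) :
    EntropyVector :=
  fun S => shannonEntropy P S.1

/-- The components of an entropy vector, with the entropy of no variable equal to zero. -/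
noncomputable def EntropyVector.H (h : EntropyVector) (S : Finset Obs) : ℝ :=
  if hS : S.Nonempty then h ⟨S, hS⟩ else 0

/-- The Shannon inequalities: positivity of entropy, positivity of conditional entropy, and
strong subadditivity. -/
def ShannonInequalities (h : EntropyVector) : Prop :=
  (∀ S, 0 ≤ h.H S) ∧
  (∀ S T, 0 ≤ h.H (S ∪ T) - h.H T) ∧
  (∀ S T U, h.H (S ∪ T ∪ U) + h.H U ≤ h.H (S ∪ U) + h.H (T ∪ U))

/-- The mutual information `I(S : T) = H(S) + H(T) - H(S T)`. -/
noncomputable def EntropyVector.mutualInfo (h : EntropyVector) (S T : Finset Obs) : ℝ :=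
  h.H S + h.H T - h.H (S ∪ T)

/-- The cone `Γ`: the Shannon inequalities together with `I(X : YZ) ≤ H(Z)`. -/
def instrumentalCone : Set EntropyVector :=
  {h | ShannonInequalities h ∧ h.mutualInfo {Obs.X} {Obs.Y, Obs.Z} ≤ h.H {Obs.Z}}

/-! ### Distributions compatible with the instrumental causal structure

`X` is drawn at random, `Z` is obtained from `X` and the subsystem `A_Z` of the resource, and
`Y` is obtained from `Z` and the subsystem `A_Y`. All observed variables take finitely many
values. -/

/-- `p` is a probability distribution on a finite set. -/
def IsDistribution {ι : Type*} [Fintype ι] (p : ι → ℝ) : Prop :=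
  (∀ i, 0 ≤ p i) ∧ ∑ i, p i = 1

/-- Compatibility when `A` is classical: `A = (A_Z, A_Y)` is a pair of random variables with
joint distribution `q`, and `kZ`, `kY` are the conditional distributions of `Z` given `X, A_Z`
and of `Y` given `Z, A_Y`. -/
def ClassicalCompatible {α : Obs → Type} [∀ o, Fintype (α o)] (P : (∀ o, α o) → ℝ) : Prop :=
  ∃ (p : α Obs.X → ℝ) (m n : ℕ) (q : Fin m × Fin n → ℝ)
    (kZ : α Obs.X → Fin m → α Obs.Z → ℝ) (kY : α Obs.Z → Fin n → α Obs.Y → ℝ),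
    IsDistribution p ∧ IsDistribution q ∧
    (∀ x a, IsDistribution (kZ x a)) ∧ (∀ z b, IsDistribution (kY z b)) ∧
    ∀ w, P w = p (w Obs.X) *
      ∑ a, ∑ b, q (a, b) * kZ (w Obs.X) a (w Obs.Z) * kY (w Obs.Z) b (w Obs.Y)

/-- `E` is a POVM on a quantum system of dimension `n`. -/
def IsPOVM {n : ℕ} {ι : Type*} [Fintype ι] (E : ι → Matrix (Fin n) (Fin n) ℂ) : Prop :=
  (∀ i, (E i).PosSemidef) ∧ ∑ i, E i = 1

/-- Compatibility when `A` is quantum: `A_Z`, `A_Y` are finite-dimensional quantum systems with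
joint density matrix `ρ`, `Z` is the outcome of a POVM on `A_Z` chosen according to `X`, and `Y`
is the outcome of a POVM on `A_Y` chosen according to `Z`. -/
def QuantumCompatible {α : Obs → Type} [∀ o, Fintype (α o)] (P : (∀ o, α o) → ℝ) : Prop :=
  ∃ (p : α Obs.X → ℝ) (m n : ℕ) (ρ : Matrix (Fin m × Fin n) (Fin m × Fin n) ℂ)
    (E : α Obs.X → α Obs.Z → Matrix (Fin m) (Fin m) ℂ)
    (F : α Obs.Z → α Obs.Y → Matrix (Fin n) (Fin n) ℂ),
    IsDistribution p ∧ ρ.PosSemidef ∧ ρ.trace = 1 ∧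
    (∀ x, IsPOVM (E x)) ∧ (∀ z, IsPOVM (F z)) ∧
    ∀ w, (P w : ℂ) = (p (w Obs.X) : ℂ) *
      (ρ * (E (w Obs.X) (w Obs.Z) ⊗ₖ F (w Obs.Z) (w Obs.Y))).trace

/-- Compatibility when `A` is a resource of the theory `G`: `A_Z`, `A_Y` are systems of `G` in a
joint state `s`, `Z` is the outcome of a measurement on `A_Z` chosen according to `X`, and `Y` is
the outcome of a measurement on `A_Y` chosen according to `Z`. -/
def GPTCompatible (G : GPT.{u, v}) {α : Obs → Type} [∀ o, Fintype (α o)]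
    (P : (∀ o, α o) → ℝ) : Prop :=
  ∃ (p : α Obs.X → ℝ) (AZ AY : G.Sys) (s : G.V (G.comp AZ AY))
    (M : α Obs.X → α Obs.Z → Module.Dual ℝ (G.V AZ))
    (N : α Obs.Z → α Obs.Y → Module.Dual ℝ (G.V AY)),
    IsDistribution p ∧ s ∈ G.state (G.comp AZ AY) ∧
    (∀ x, G.IsMeas AZ (M x)) ∧ (∀ z, G.IsMeas AY (N z)) ∧
    ∀ w, P w = p (w Obs.X) *
      G.effTens AZ AY (M (w Obs.X) (w Obs.Z)) (N (w Obs.Z) (w Obs.Y)) s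

/-- Achievable entropy vectors of the observed variables with a classical resource. -/
def classicalEntropyVectors : Set EntropyVector :=
  {h | ∃ (α : Obs → Type) (_ : ∀ o, Fintype (α o)) (P : (∀ o, α o) → ℝ),
    ClassicalCompatible P ∧ h = entropyVector P}

/-- Achievable entropy vectors of the observed variables with a quantum resource. -/
def quantumEntropyVectors : Set EntropyVector :=
  {h | ∃ (α : Obs → Type) (_ : ∀ o, Fintype (α o)) (P : (∀ o, α o) → ℝ),
    QuantumCompatible P ∧ h = entropyVector P}

/-- Achievable entropy vectors of the observed variables with a resource of the theory `G`. -/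
def gptEntropyVectors (G : GPT.{u, v}) : Set EntropyVector :=
  {h | ∃ (α : Obs → Type) (_ : ∀ o, Fintype (α o)) (P : (∀ o, α o) → ℝ),
    GPTCompatible G P ∧ h = entropyVector P}

/-! Necessity. In all three theories the resource gives a no-signalling box `τ x z z' y`, and `P`
arises by feeding the outcome `z` back as the input `z'`. By no-signalling the marginal `r z' y`
does not depend on `x`, and a single term is at most the sum, so `P(x,y,z) ≤ p(x) r(y|z)`. Taking
logarithms and applying Gibbs' inequality to `r` gives `H(YZ|X) ≥ H(Y|Z)`, which is `I(X:YZ) ≤ H(Z)`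
(`rvEntropy_cond_le`, `entropyVector_mem_of_noSignalling`). The Shannon inequalities hold for every
distribution, and the cone is closed.

Sufficiency. Deterministic responses to shared randomness are available in all three theories. The
closure of their entropy vectors is a convex cone: independent strategies add, and running many
copies with small probability scales by any `c ≥ 0`, at the cost of a vanishing binary entropy
(`smul_mem_closure_sharedEntropyVectors`).

It remains to reach generators. The three-variable Shannon cone is generated by one bit shared by
each nonempty set of variables, together with the xor vector. Only the bit shared by X and Y alone
violates `I(X:YZ) ≤ H(Z)`, by 1. The slack is 1 on the bits of Z and of YZ and 0 on the others, so
the cut replaces XY by XY + Z and XY + YZ. Two uniform bits realise all nine resulting vectors, the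
last two through a one-time pad. -/

/-! ### Entropies of random variables on a finite probability space -/

section Entropy

open scoped Classical

variable {Ω : Type*} [Fintype Ω] {K K' K₀ K₁ K₂ : Type*}

/-- The probability, under the weights `P`, that the random variable `k` takes the value that it
has at `x`. -/
noncomputable def mass (P : Ω → ℝ) (k : Ω → K) (x : Ω) : ℝ :=
  ∑ y, if k y = k x then P y else 0

/-- The Shannon entropy, in bits, of the random variable `k` under the weights `P`. -/
noncomputable def rvEntropy (P : Ω → ℝ) (k : Ω → K) : ℝ :=
  -∑ x, P x * Real.logb 2 (mass P k x)

theorem mass_congr (P : Ω → ℝ) (k : Ω → K) {x y : Ω} (h : k x = k y) :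
    mass P k x = mass P k y := by
  simp only [mass, h]

theorem mass_congr_ker (P : Ω → ℝ) {k : Ω → K} {k' : Ω → K'} {x : Ω}
    (h : ∀ y, k y = k x ↔ k' y = k' x) : mass P k x = mass P k' x := by
  simp only [mass, h]

/-- Entropy depends only on the partition into level sets, so the types of values need not be finite
and may be exchanged freely. -/
theorem rvEntropy_congr (P : Ω → ℝ) {k : Ω → K} {k' : Ω → K'}
    (h : ∀ x y, k x = k y ↔ k' x = k' y) : rvEntropy P k = rvEntropy P k' := by
  simp only [rvEntropy, fun x => mass_congr_ker P (fun y => h y x)]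

theorem mass_nonneg {P : Ω → ℝ} (hP : ∀ x, 0 ≤ P x) (k : Ω → K) (x : Ω) : 0 ≤ mass P k x :=
  Finset.sum_nonneg fun y _ => by split_ifs <;> simp [hP]

theorem le_mass {P : Ω → ℝ} (hP : ∀ x, 0 ≤ P x) (k : Ω → K) (x : Ω) : P x ≤ mass P k x := by
  have := Finset.single_le_sum (f := fun y => if k y = k x then P y else 0)
    (fun y _ => by split_ifs <;> simp [hP]) (Finset.mem_univ x)
  simpa [mass] using this

theorem mass_pos {P : Ω → ℝ} (hP : ∀ x, 0 ≤ P x) (k : Ω → K) {x : Ω} (hx : 0 < P x) :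
    0 < mass P k x :=
  hx.trans_le (le_mass hP k x)

theorem mass_mono {P : Ω → ℝ} (hP : ∀ x, 0 ≤ P x) {k : Ω → K} {k' : Ω → K'}
    (h : ∀ x y, k x = k y → k' x = k' y) (x : Ω) : mass P k x ≤ mass P k' x := by
  refine Finset.sum_le_sum fun y _ => ?_
  by_cases hk : k y = k x
  · simp [hk, h _ _ hk]
  · rw [if_neg hk]; split_ifs <;> simp [hP]

theorem mass_le_one {P : Ω → ℝ} (hP : IsDistribution P) (k : Ω → K) (x : Ω) :
    mass P k x ≤ 1 := by
  rw [← hP.2]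
  exact Finset.sum_le_sum fun y _ => by split_ifs <;> simp [hP.1]

theorem rvEntropy_nonneg {P : Ω → ℝ} (hP : IsDistribution P) (k : Ω → K) :
    0 ≤ rvEntropy P k := by
  rw [rvEntropy, neg_nonneg]
  exact Finset.sum_nonpos fun x _ => mul_nonpos_of_nonneg_of_nonpos (hP.1 x)
    (Real.logb_nonpos (by norm_num) (mass_nonneg hP.1 k x) (mass_le_one hP k x))

theorem rvEntropy_mono {P : Ω → ℝ} (hP : IsDistribution P) {k : Ω → K} {k' : Ω → K'}
    (h : ∀ x y, k x = k y → k' x = k' y) : rvEntropy P k' ≤ rvEntropy P k := by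
  rw [rvEntropy, rvEntropy, neg_le_neg_iff]
  refine Finset.sum_le_sum fun x _ => ?_
  rcases (hP.1 x).eq_or_lt with hx | hx
  · simp [← hx]
  · exact mul_le_mul_of_nonneg_left (Real.logb_le_logb_of_le (by norm_num)
      (mass_pos hP.1 k hx) (mass_mono hP.1 h x)) hx.le

/-- Gibbs' inequality, from `log t ≤ t - 1`; positivity of `t` matters only on the support of `P`.
-/
theorem sum_mul_logb_nonpos {P : Ω → ℝ} (hP : IsDistribution P) {t : Ω → ℝ}
    (ht : ∀ x, 0 < P x → 0 < t x) (hsum : ∑ x, P x * t x ≤ 1) :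
    ∑ x, P x * Real.logb 2 (t x) ≤ 0 := by
  have h2 : 0 < Real.log 2 := Real.log_pos (by norm_num)
  have h : ∀ x, P x * Real.logb 2 (t x) ≤ (P x * t x - P x) / Real.log 2 := by
    intro x
    rcases (hP.1 x).eq_or_lt with hx | hx
    · simp [← hx]
    · have := Real.log_le_sub_one_of_pos (ht x hx)
      rw [Real.logb, ← mul_div_assoc, div_le_div_iff_of_pos_right h2]
      nlinarith
  refine (Finset.sum_le_sum fun x _ => h x).trans ?_
  rw [← Finset.sum_div, Finset.sum_sub_distrib, hP.2]
  exact div_nonpos_of_nonpos_of_nonneg (by linarith) h2.le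

/-- All terms with `T` lie in one level set of `k` and share its mass as denominator. A level set of
mass zero contributes `0 / 0 = 0`. -/
theorem sum_div_mass_le_one {P : Ω → ℝ} (hP : ∀ x, 0 ≤ P x) (k : Ω → K) (T : Ω → Prop)
    [DecidablePred T] (hT : ∀ x y, T x → T y → k x = k y) :
    ∑ x, (if T x then P x / mass P k x else 0) ≤ 1 := by
  by_cases hne : ∃ x₀, T x₀
  · obtain ⟨x₀, h₀⟩ := hne
    have h : ∀ x, (if T x then P x / mass P k x else 0) ≤
        (if k x = k x₀ then P x else 0) / mass P k x₀ := by
      intro x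
      by_cases hx : T x
      · have := hT x x₀ hx h₀
        rw [if_pos hx, if_pos this, mass_congr P k this]
      · rw [if_neg hx]
        exact div_nonneg (by split_ifs <;> simp [hP]) (mass_nonneg hP k x₀)
    refine (Finset.sum_le_sum fun x _ => h x).trans ?_
    rw [← Finset.sum_div]
    exact div_self_le_one _
  · push Not at hne
    simp [hne]

/-- Strong subadditivity of the Shannon entropy. -/
theorem rvEntropy_submodular {P : Ω → ℝ} (hP : IsDistribution P) {k : Ω → K} {k₀ : Ω → K₀}
    {k₁ : Ω → K₁} {k₂ : Ω → K₂} (h : ∀ x y, k₁ x = k₁ y → k₂ x = k₂ y → k x = k y)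
    (h₁ : ∀ x y, k₁ x = k₁ y → k₀ x = k₀ y) (h₂ : ∀ x y, k₂ x = k₂ y → k₀ x = k₀ y) :
    rvEntropy P k + rvEntropy P k₀ ≤ rvEntropy P k₁ + rvEntropy P k₂ := by
  -- The claim says that the expectation of `log t` is at most zero, so by Gibbs it is enough that
  -- `t` has expectation at most 1.
  set t : Ω → ℝ := fun x =>
    mass P k₁ x * mass P k₂ x / (mass P k x * mass P k₀ x) with ht
  have hsum : ∑ x, P x * t x ≤ 1 := by
    have h_exp : ∀ x, P x * t x = ∑ y, ∑ z, (P y * P z / mass P k₀ y) *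
        (if k₁ y = k₁ x ∧ k₂ z = k₂ x then P x / mass P k x else 0) := by
      intro x
      have : P x * t x = mass P k₁ x * mass P k₂ x * (P x / mass P k x / mass P k₀ x) := by
        simp only [ht]; ring
      rw [this]
      conv_lhs => rw [mass, mass]
      rw [Finset.sum_mul_sum, Finset.sum_mul]
      refine Finset.sum_congr rfl fun y _ => ?_
      rw [Finset.sum_mul]
      refine Finset.sum_congr rfl fun z _ => ?_
      by_cases hy : k₁ y = k₁ x
      · by_cases hz : k₂ z = k₂ x
        · simp only [hy, hz, and_self, if_true, mass_congr P k₀ (h₁ _ _ hy)]; ring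
        · simp [hz]
      · simp [hy]
    -- The points `x` compatible with given `k₁ y` and `k₂ z` have a common value of `k`, and exist
    -- only if `k₀ y = k₀ z`.
    have h_in : ∀ y z, ∑ x, (if k₁ y = k₁ x ∧ k₂ z = k₂ x then P x / mass P k x else 0) ≤
        if k₀ z = k₀ y then 1 else 0 := by
      intro y z
      by_cases hyz : k₀ z = k₀ y
      · rw [if_pos hyz]
        exact sum_div_mass_le_one hP.1 k (fun x => k₁ y = k₁ x ∧ k₂ z = k₂ x)
          fun a b ha hb => h _ _ (ha.1.symm.trans hb.1) (ha.2.symm.trans hb.2)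
      · rw [if_neg hyz]
        refine (Finset.sum_eq_zero fun x _ => if_neg ?_).le
        rintro ⟨hy, hz⟩
        exact hyz ((h₂ _ _ hz).trans (h₁ _ _ hy).symm)
    calc ∑ x, P x * t x
        = ∑ y, ∑ z, (P y * P z / mass P k₀ y) *
          ∑ x, (if k₁ y = k₁ x ∧ k₂ z = k₂ x then P x / mass P k x else 0) := by
          simp only [h_exp, Finset.mul_sum]
          rw [Finset.sum_comm]
          exact Finset.sum_congr rfl fun y _ => Finset.sum_comm
      _ ≤ ∑ y, ∑ z, (P y * P z / mass P k₀ y) * (if k₀ z = k₀ y then 1 else 0) :=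
          Finset.sum_le_sum fun y _ => Finset.sum_le_sum fun z _ =>
            mul_le_mul_of_nonneg_left (h_in y z)
              (div_nonneg (mul_nonneg (hP.1 y) (hP.1 z)) (mass_nonneg hP.1 _ _))
      _ = ∑ y, P y * (mass P k₀ y / mass P k₀ y) := by
          refine Finset.sum_congr rfl fun y _ => ?_
          conv_rhs => rw [mass, Finset.sum_div, Finset.mul_sum]
          refine Finset.sum_congr rfl fun z _ => ?_
          split_ifs
          · change _ = P y * (P z / mass P k₀ y); ring
          · simp
      _ ≤ ∑ y, P y := Finset.sum_le_sum fun y _ =>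
          mul_le_of_le_one_right (hP.1 y) (div_self_le_one _)
      _ = 1 := hP.2
  have hlog := sum_mul_logb_nonpos hP (t := t) (fun x hx => by
    have h1 := mass_pos hP.1 k₁ hx
    have h2 := mass_pos hP.1 k₂ hx
    have h3 := mass_pos hP.1 k hx
    have h4 := mass_pos hP.1 k₀ hx
    positivity) hsum
  have h_eq : ∀ x, P x * Real.logb 2 (t x) =
      P x * Real.logb 2 (mass P k₁ x) + P x * Real.logb 2 (mass P k₂ x) -
      (P x * Real.logb 2 (mass P k x) + P x * Real.logb 2 (mass P k₀ x)) := by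
    intro x
    rcases (hP.1 x).eq_or_lt with hx | hx
    · simp [← hx]
    · have h1 := (mass_pos hP.1 k₁ hx).ne'
      have h2 := (mass_pos hP.1 k₂ hx).ne'
      have h3 := (mass_pos hP.1 k hx).ne'
      have h4 := (mass_pos hP.1 k₀ hx).ne'
      simp only [ht]
      rw [Real.logb_div (mul_ne_zero h1 h2) (mul_ne_zero h3 h4), Real.logb_mul h1 h2,
        Real.logb_mul h3 h4]
      ring
  simp only [h_eq, Finset.sum_sub_distrib, Finset.sum_add_distrib] at hlog
  simp only [rvEntropy]
  linarith

/-- If, given `k₀`, the conditional probability of `k` is at most `r`, and `r` is, for each value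
of `k₁`, normalised over the values of `k₂`, then `H(k|k₀) ≥ H(k₂|k₁)`. -/
theorem rvEntropy_cond_le [Fintype K₂] {P : Ω → ℝ} (hP : IsDistribution P) (k₀ : Ω → K₀)
    (k₁ : Ω → K₁) (k₂ : Ω → K₂) {r : K₁ → K₂ → ℝ} (hr : ∀ a b, 0 ≤ r a b)
    (hr1 : ∀ a, ∑ b, r a b = 1) (hle : ∀ x, P x ≤ mass P k₀ x * r (k₁ x) (k₂ x)) :
    rvEntropy P (fun x => (k₂ x, k₁ x)) - rvEntropy P k₁ ≤
      rvEntropy P (id : Ω → Ω) - rvEntropy P k₀ := by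
  set k : Ω → K₂ × K₁ := fun x => (k₂ x, k₁ x) with hk
  -- Ratio of `r` to the true conditional probability of `k₂` given `k₁`.
  set t : Ω → ℝ := fun x => mass P k₁ x * r (k₁ x) (k₂ x) / mass P k x with ht
  have hrpos : ∀ x, 0 < P x → 0 < r (k₁ x) (k₂ x) := fun x hx =>
    pos_of_mul_pos_right (hx.trans_le (hle x)) (mass_nonneg hP.1 _ _)
  have hsum : ∑ x, P x * t x ≤ 1 := by
    have h_exp : ∀ x, P x * t x = ∑ y, P y * ∑ b, r (k₁ y) b *
        (if k₂ x = b ∧ k₁ x = k₁ y then P x / mass P k x else 0) := by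
      intro x
      have : P x * t x = mass P k₁ x * (r (k₁ x) (k₂ x) * (P x / mass P k x)) := by
        simp only [ht]; ring
      rw [this]
      conv_lhs => rw [mass]
      rw [Finset.sum_mul]
      refine Finset.sum_congr rfl fun y _ => ?_
      by_cases hy : k₁ y = k₁ x
      · simp [hy]
      · simp [hy, Ne.symm hy]
    calc ∑ x, P x * t x
        = ∑ y, P y * ∑ b, r (k₁ y) b *
          ∑ x, (if k₂ x = b ∧ k₁ x = k₁ y then P x / mass P k x else 0) := by
          simp only [h_exp]
          rw [Finset.sum_comm]
          refine Finset.sum_congr rfl fun y _ => ?_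
          rw [← Finset.mul_sum, Finset.sum_comm]
          simp only [Finset.mul_sum]
      _ ≤ ∑ y, P y * ∑ b, r (k₁ y) b * 1 :=
          Finset.sum_le_sum fun y _ => mul_le_mul_of_nonneg_left
            (Finset.sum_le_sum fun b _ => mul_le_mul_of_nonneg_left
              (sum_div_mass_le_one hP.1 k (fun x => k₂ x = b ∧ k₁ x = k₁ y)
                fun x z hx hz => Prod.ext (hx.1.trans hz.1.symm) (hx.2.trans hz.2.symm))
              (hr _ _)) (hP.1 y)
      _ = 1 := by simp only [mul_one, hr1, hP.2]
  have hlog := sum_mul_logb_nonpos hP (t := t) (fun x hx => by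
    have h1 := mass_pos hP.1 k₁ hx
    have h2 := hrpos x hx
    have h3 := mass_pos hP.1 k hx
    positivity) hsum
  have hid : ∀ x, mass P (id : Ω → Ω) x = P x := fun x => by simp [mass]
  -- The logarithm of `hle` replaces `r` by the conditional probability `P x / mass P k₀ x`.
  have h_le : ∀ x, P x * Real.logb 2 (mass P k₁ x) + P x * Real.logb 2 (mass P id x) -
      (P x * Real.logb 2 (mass P k₀ x) + P x * Real.logb 2 (mass P k x)) ≤
      P x * Real.logb 2 (t x) := by
    intro x
    rcases (hP.1 x).eq_or_lt with hx | hx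
    · simp [← hx]
    · have h0 := mass_pos hP.1 k₀ hx
      have h1 := mass_pos hP.1 k₁ hx
      have h2 := hrpos x hx
      have h3 := mass_pos hP.1 k hx
      have := Real.logb_le_logb_of_le (b := 2) (by norm_num) hx (hle x)
      rw [Real.logb_mul h0.ne' h2.ne'] at this
      simp only [ht]
      rw [Real.logb_div (mul_pos h1 h2).ne' h3.ne', Real.logb_mul h1.ne' h2.ne', hid]
      nlinarith
  have := (Finset.sum_le_sum fun x (_ : x ∈ Finset.univ) => h_le x).trans hlog
  simp only [Finset.sum_sub_distrib, Finset.sum_add_distrib] at this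
  simp only [rvEntropy]
  linarith

end Entropy

/-! ### Entropies of marginals as entropies of random variables -/

section Pushforward

open scoped Classical

variable {Ω : Type*} [Fintype Ω] {α : Obs → Type} [∀ o, Fintype (α o)]

/-- The joint distribution of the observed variables `W` under the weights `μ`. -/
noncomputable def pushforward (μ : Ω → ℝ) (W : Ω → ∀ o, α o) (w : ∀ o, α o) : ℝ :=
  ∑ ω, if W ω = w then μ ω else 0

theorem marginal_pushforward (μ : Ω → ℝ) (W : Ω → ∀ o, α o) (S : Finset Obs)
    (w : ∀ o : S, α o) :
    marginal (pushforward μ W) S w = ∑ ω, if (fun o : S => W ω o) = w then μ ω else 0 := by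
  simp only [marginal, pushforward, Finset.sum_filter]
  calc _ = ∑ x, ∑ ω, if W ω = x then (if (fun o : S => W ω o) = w then μ ω else 0) else 0 := by
        refine Finset.sum_congr rfl fun x _ => ?_
        split_ifs with h
        · refine Finset.sum_congr rfl fun ω _ => ?_
          by_cases hx : W ω = x
          · rw [if_pos hx, if_pos hx, if_pos (by subst hx; exact funext h)]
          · simp [hx]
        · refine (Finset.sum_eq_zero fun ω _ => ?_).symm
          by_cases hx : W ω = x
          · rw [if_pos hx, if_neg (by subst hx; exact fun h' => h (congrFun h'))]
          · simp [hx]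
    _ = _ := by
        rw [Finset.sum_comm]
        simp

theorem shannonEntropy_pushforward (μ : Ω → ℝ) (W : Ω → ∀ o, α o) (S : Finset Obs) :
    shannonEntropy (pushforward μ W) S = rvEntropy μ (fun ω (o : S) => W ω o) := by
  rw [shannonEntropy, rvEntropy, neg_inj]
  simp only [marginal_pushforward]
  simp only [Finset.sum_mul]
  rw [Finset.sum_comm]
  refine Finset.sum_congr rfl fun ω _ => ?_
  simp only [ite_mul, zero_mul]
  rw [Finset.sum_ite_eq, if_pos (Finset.mem_univ _), mass]
  congr!

theorem pushforward_id (P : (∀ o, α o) → ℝ) : pushforward P id = P := by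
  funext w; simp [pushforward]

theorem shannonEntropy_eq_rvEntropy (P : (∀ o, α o) → ℝ) (S : Finset Obs) :
    shannonEntropy P S = rvEntropy P (fun w (o : S) => w o) := by
  conv_lhs => rw [← pushforward_id P, shannonEntropy_pushforward]
  rfl

theorem entropyVector_H {P : (∀ o, α o) → ℝ} (hP : ∑ w, P w = 1) (S : Finset Obs) :
    (entropyVector P).H S = rvEntropy P (fun w (o : S) => w o) := by
  rw [EntropyVector.H]
  split_ifs with hS
  · exact shannonEntropy_eq_rvEntropy P S
  · rw [Finset.not_nonempty_iff_eq_empty] at hS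
    subst hS
    -- The default value 0 for the empty set is the true entropy: the only level set has mass 1.
    have h : ∀ w, mass P (fun (w : ∀ o, α o) (o : (∅ : Finset Obs)) => w o) w = 1 := by
      intro w
      rw [← hP, mass]
      exact Finset.sum_congr rfl fun x _ => if_pos (Subsingleton.elim _ _)
    simp [rvEntropy, h]

end Pushforward

/-! ### Necessity of the inequalities -/

/-- The values of the three observed variables as a triple. -/
def obsEquiv (α : Obs → Type) : (∀ o, α o) ≃ α Obs.X × α Obs.Z × α Obs.Y where
  toFun w := (w Obs.X, w Obs.Z, w Obs.Y)
  invFun t o := match o with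
    | Obs.X => t.1
    | Obs.Y => t.2.2
    | Obs.Z => t.2.1
  left_inv w := by funext o; cases o <;> rfl
  right_inv _ := rfl

theorem sum_obs {α : Obs → Type} [∀ o, Fintype (α o)]
    (F : α Obs.X → α Obs.Z → α Obs.Y → ℝ) :
    ∑ w : ∀ o, α o, F (w Obs.X) (w Obs.Z) (w Obs.Y) = ∑ x, ∑ z, ∑ y, F x z y := by
  refine ((obsEquiv α).sum_comp (fun t => F t.1 t.2.1 t.2.2)).trans ?_
  simp only [Fintype.sum_prod_type]

theorem restrict_eq_iff {α : Obs → Type} {S : Finset Obs} {x y : ∀ o, α o} :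
    ((fun o : S => x o) = fun o : S => y o) ↔ ∀ o ∈ S, x o = y o :=
  ⟨fun h o ho => congrFun h ⟨o, ho⟩, fun h => funext fun o => h o o.2⟩

theorem shannonInequalities_entropyVector {α : Obs → Type} [∀ o, Fintype (α o)]
    {P : (∀ o, α o) → ℝ} (hP : IsDistribution P) : ShannonInequalities (entropyVector P) := by
  refine ⟨fun S => ?_, fun S T => ?_, fun S T U => ?_⟩ <;> simp only [entropyVector_H hP.2]
  · exact rvEntropy_nonneg hP _
  · refine sub_nonneg.2 (rvEntropy_mono hP fun x y h => ?_)
    rw [restrict_eq_iff] at h ⊢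
    exact fun o ho => h o (Finset.mem_union_right _ ho)
  · refine rvEntropy_submodular hP (fun x y h₁ h₂ => ?_) (fun x y h => ?_) (fun x y h => ?_)
    · rw [restrict_eq_iff] at h₁ h₂ ⊢
      intro o ho
      simp only [Finset.mem_union] at ho h₁ h₂
      rcases ho with (ho | ho) | ho
      · exact h₁ o (Or.inl ho)
      · exact h₂ o (Or.inl ho)
      · exact h₁ o (Or.inr ho)
    all_goals
      rw [restrict_eq_iff] at h ⊢
      exact fun o ho => h o (Finset.mem_union_right _ ho)

/-- A no-signalling box `τ x z z' y`, with inputs `x`, `z'` and outcomes `z`, `y`, gives entropy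
vectors in the cone when its second input is connected to its first outcome. -/
theorem entropyVector_mem_of_noSignalling {α : Obs → Type} [∀ o, Fintype (α o)]
    {P : (∀ o, α o) → ℝ} {p : α Obs.X → ℝ} {τ : α Obs.X → α Obs.Z → α Obs.Z → α Obs.Y → ℝ}
    {l : α Obs.X → α Obs.Z → ℝ} {r : α Obs.Z → α Obs.Y → ℝ} (hp : IsDistribution p)
    (hτ : ∀ x z z' y, 0 ≤ τ x z z' y) (hl : ∀ x z z', ∑ y, τ x z z' y = l x z)
    (hr : ∀ x z' y, ∑ z, τ x z z' y = r z' y) (hl1 : ∀ x, ∑ z, l x z = 1)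
    (hr1 : ∀ z, ∑ y, r z y = 1)
    (hP : ∀ w, P w = p (w Obs.X) * τ (w Obs.X) (w Obs.Z) (w Obs.Z) (w Obs.Y)) :
    entropyVector P ∈ instrumentalCone := by
  classical
  have hdist : IsDistribution P := by
    refine ⟨fun w => by rw [hP]; exact mul_nonneg (hp.1 _) (hτ _ _ _ _), ?_⟩
    simp only [hP]
    rw [sum_obs (fun x z y => p x * τ x z z y)]
    simp only [← Finset.mul_sum, hl, hl1, mul_one, hp.2]
  refine ⟨shannonInequalities_entropyVector hdist, ?_⟩
  have hmass : ∀ w, mass P (fun w => w Obs.X) w = p (w Obs.X) := by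
    intro w
    simp only [mass, hP]
    rw [sum_obs (fun x z y => @ite _ (x = w Obs.X) (Classical.propDecidable _)
      (p x * τ x z z y) 0)]
    rw [Finset.sum_eq_single (w Obs.X)]
    · simp only [if_true, ← Finset.mul_sum, hl, hl1, mul_one]
    · intro x _ hx
      simp [hx]
    · simp
  obtain ⟨x₀⟩ : Nonempty (α Obs.X) := by
    by_contra h
    rw [not_nonempty_iff] at h
    simpa using hp.2
  -- `τ x z z y` is one term of the sum over the first outcome that gives `r z y`; a value `x₀` of
  -- `X` is needed for `r` to be nonnegative.
  have key := rvEntropy_cond_le hdist (fun w => w Obs.X) (fun w => w Obs.Z) (fun w => w Obs.Y)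
    (r := r) (fun z y => by rw [← hr x₀]; exact Finset.sum_nonneg fun z' _ => hτ _ _ _ _) hr1
    (fun w => by
      rw [hmass, hP, ← hr (w Obs.X)]
      exact mul_le_mul_of_nonneg_left (Finset.single_le_sum
        (f := fun z => τ (w Obs.X) z (w Obs.Z) (w Obs.Y)) (fun z _ => hτ _ _ _ _)
        (Finset.mem_univ _)) (hp.1 _))
  rw [EntropyVector.mutualInfo]
  simp only [entropyVector_H hdist.2]
  rw [rvEntropy_congr P (k := fun w (o : ({Obs.X} : Finset Obs)) => w o)
      (k' := fun w => w Obs.X) (fun x y => by rw [restrict_eq_iff]; simp),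
    rvEntropy_congr P (k := fun w (o : ({Obs.Z} : Finset Obs)) => w o)
      (k' := fun w => w Obs.Z) (fun x y => by rw [restrict_eq_iff]; simp),
    rvEntropy_congr P (k := fun w (o : ({Obs.Y, Obs.Z} : Finset Obs)) => w o)
      (k' := fun w => (w Obs.Y, w Obs.Z)) (fun x y => by rw [restrict_eq_iff]; simp),
    rvEntropy_congr P (k := fun w (o : ({Obs.X} ∪ {Obs.Y, Obs.Z} : Finset Obs)) => w o)
      (k' := id) (fun x y => by
        rw [restrict_eq_iff]
        constructor
        · intro h; funext o; exact h o (by cases o <;> decide)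
        · rintro h o -; exact congrFun h o)]
  linarith

/-- No-signalling holds because each local measurement sums to the unit effect and the product of
effects is bilinear. -/
theorem gptEntropyVectors_subset (G : GPT.{u, v}) : gptEntropyVectors G ⊆ instrumentalCone := by
  rintro _ ⟨α, _, P, ⟨p, AZ, AY, s, M, N, hp, hs, hM, hN, hP⟩, rfl⟩
  refine entropyVector_mem_of_noSignalling (p := p)
    (τ := fun x z z' y => G.effTens AZ AY (M x z) (N z' y) s)
    (l := fun x z => G.effTens AZ AY (M x z) (G.unit AY) s)
    (r := fun z y => G.effTens AZ AY (G.unit AZ) (N z y) s)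
    hp ?_ ?_ ?_ ?_ ?_ hP
  · intro x z z' y
    exact (G.effect_mem _ _ (G.meas_effect _ _ (G.tens_meas AZ AY _ _ (hM x) (hN z'))
      (z, y)) s hs).1
  · intro x z z'
    rw [← G.meas_sum AY _ (hN z'), map_sum, LinearMap.sum_apply]
  · intro x z y
    rw [← G.meas_sum AZ _ (hM x), map_sum, LinearMap.sum_apply, LinearMap.sum_apply]
  · intro x
    by_cases hZ : Nonempty (α Obs.Z)
    -- No axiom identifies the product of unit effects with the joint unit; on `s`, normalisation
    -- comes from summing a product measurement.
    · obtain ⟨z⟩ := hZ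
      have := G.meas_sum _ _ (G.tens_meas AZ AY _ _ (hM x) (hN z))
      rw [← G.unit_state _ s hs, ← this, ← G.meas_sum AY _ (hN z)]
      simp only [map_sum, LinearMap.sum_apply, Fintype.sum_prod_type]
    -- Without values of `Z` the unit effect of `AZ` would be an empty sum, hence 0, yet it is 1 on
    -- a reduced state.
    · rw [not_nonempty_iff] at hZ
      obtain ⟨t, ht, -⟩ := G.reduced_left AZ AY s hs
      have h := G.unit_state AZ t ht
      rw [← G.meas_sum AZ _ (hM x)] at h
      simp at h
  · intro z
    obtain ⟨x⟩ : Nonempty (α Obs.X) := by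
      by_contra h
      rw [not_nonempty_iff] at h
      simpa using hp.2
    have := G.meas_sum _ _ (G.tens_meas AZ AY _ _ (hM x) (hN z))
    rw [← G.unit_state _ s hs, ← this, ← G.meas_sum AZ _ (hM x)]
    simp only [map_sum, LinearMap.sum_apply, Fintype.sum_prod_type]
    exact Finset.sum_comm

-- With `B = C⋆ C`, cyclicity turns the trace into that of `C A C⋆`.
open scoped MatrixOrder in
theorem Matrix.PosSemidef.trace_mul_nonneg {n : Type*} [Fintype n] [DecidableEq n]
    {A B : Matrix n n ℂ} (hA : A.PosSemidef) (hB : B.PosSemidef) : 0 ≤ (A * B).trace := by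
  obtain ⟨C, rfl⟩ := CStarAlgebra.nonneg_iff_eq_star_mul_self.mp hB.nonneg
  rw [← Matrix.mul_assoc, Matrix.trace_mul_comm, ← Matrix.mul_assoc]
  exact (hA.mul_mul_conjTranspose_same C).trace_nonneg

theorem sum_kronecker {ι m n : Type*} (s : Finset ι) (A : ι → Matrix m m ℂ) (B : Matrix n n ℂ) :
    (∑ i ∈ s, A i) ⊗ₖ B = ∑ i ∈ s, A i ⊗ₖ B := by
  ext i j
  simp [Matrix.sum_apply, Finset.sum_mul]

theorem kronecker_sum {ι m n : Type*} (s : Finset ι) (A : Matrix m m ℂ) (B : ι → Matrix n n ℂ) :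
    A ⊗ₖ (∑ i ∈ s, B i) = ∑ i ∈ s, A ⊗ₖ B i := by
  ext i j
  simp [Matrix.sum_apply, Finset.mul_sum]

theorem quantumEntropyVectors_subset : quantumEntropyVectors ⊆ instrumentalCone := by
  rintro _ ⟨α, _, P, ⟨p, m, n, ρ, E, F, hp, hρ, hρ1, hE, hF, hP⟩, rfl⟩
  refine entropyVector_mem_of_noSignalling (p := p)
    (τ := fun x z z' y => (ρ * (E x z ⊗ₖ F z' y)).trace.re)
    (l := fun x z => (ρ * (E x z ⊗ₖ 1)).trace.re)
    (r := fun z y => (ρ * (1 ⊗ₖ F z y)).trace.re) hp ?_ ?_ ?_ ?_ ?_ ?_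
  · intro x z z' y
    exact (Complex.nonneg_iff.1 (hρ.trace_mul_nonneg (((hE x).1 z).kronecker ((hF z').1 y)))).1
  · intro x z z'
    rw [← (hF z').2, kronecker_sum, Matrix.mul_sum, Matrix.trace_sum, Complex.re_sum]
  · intro x z' y
    rw [← (hE x).2, sum_kronecker, Matrix.mul_sum, Matrix.trace_sum, Complex.re_sum]
  · intro x
    rw [← Complex.re_sum, ← Matrix.trace_sum, ← Matrix.mul_sum, ← sum_kronecker, (hE x).2,
      Matrix.one_kronecker_one, mul_one, hρ1, Complex.one_re]
  · intro z
    rw [← Complex.re_sum, ← Matrix.trace_sum, ← Matrix.mul_sum, ← kronecker_sum, (hF z).2,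
      Matrix.one_kronecker_one, mul_one, hρ1, Complex.one_re]
  · intro w
    have := congrArg Complex.re (hP w)
    simpa using this

/-- Classical data are embedded as diagonal matrices. -/
theorem ClassicalCompatible.quantumCompatible {α : Obs → Type} [∀ o, Fintype (α o)]
    {P : (∀ o, α o) → ℝ} (h : ClassicalCompatible P) : QuantumCompatible P := by
  obtain ⟨p, m, n, q, kZ, kY, hp, hq, hZ, hY, hP⟩ := h
  refine ⟨p, m, n, Matrix.diagonal fun c => (q c : ℂ),
    fun x z => Matrix.diagonal fun a => (kZ x a z : ℂ),
    fun z y => Matrix.diagonal fun b => (kY z b y : ℂ), hp, ?_, ?_, ?_, ?_, ?_⟩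
  · exact Matrix.PosSemidef.diagonal fun c => by simpa using hq.1 c
  · rw [Matrix.trace_diagonal]
    exact_mod_cast hq.2
  · refine fun x => ⟨fun z => Matrix.PosSemidef.diagonal fun a => by simpa using (hZ x a).1 z, ?_⟩
    ext i j
    rw [Matrix.sum_apply]
    by_cases hij : i = j
    · subst hij
      simp only [Matrix.diagonal_apply_eq, Matrix.one_apply_eq]
      exact_mod_cast (hZ x i).2
    · simp [Matrix.diagonal_apply_ne _ hij, Matrix.one_apply_ne hij]
  · refine fun z => ⟨fun y => Matrix.PosSemidef.diagonal fun b => by simpa using (hY z b).1 y, ?_⟩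
    ext i j
    rw [Matrix.sum_apply]
    by_cases hij : i = j
    · subst hij
      simp only [Matrix.diagonal_apply_eq, Matrix.one_apply_eq]
      exact_mod_cast (hY z i).2
    · simp [Matrix.diagonal_apply_ne _ hij, Matrix.one_apply_ne hij]
  · intro w
    rw [hP w, Matrix.diagonal_kronecker_diagonal, Matrix.diagonal_mul_diagonal,
      Matrix.trace_diagonal, Fintype.sum_prod_type]
    push_cast
    simp only [mul_assoc]

theorem classicalEntropyVectors_subset_quantum :
    classicalEntropyVectors ⊆ quantumEntropyVectors := by
  rintro _ ⟨α, _, P, hP, rfl⟩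
  exact ⟨α, _, P, hP.quantumCompatible, rfl⟩

/-! ### Closedness of the cone -/

theorem continuous_entropyVector_H (S : Finset Obs) :
    Continuous fun h : EntropyVector => h.H S := by
  by_cases hS : S.Nonempty
  · simpa only [EntropyVector.H, hS, dif_pos] using continuous_apply _
  · simpa only [EntropyVector.H, hS, dif_neg, not_false_eq_true] using continuous_const

theorem isClosed_instrumentalCone : IsClosed instrumentalCone := by
  have hc := continuous_entropyVector_H
  have : instrumentalCone = ((⋂ S, {h : EntropyVector | 0 ≤ h.H S}) ∩
      ((⋂ S, ⋂ T, {h : EntropyVector | 0 ≤ h.H (S ∪ T) - h.H T}) ∩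
      (⋂ S, ⋂ T, ⋂ U, {h : EntropyVector |
        h.H (S ∪ T ∪ U) + h.H U ≤ h.H (S ∪ U) + h.H (T ∪ U)}))) ∩
      {h : EntropyVector | h.mutualInfo {Obs.X} {Obs.Y, Obs.Z} ≤ h.H {Obs.Z}} := by
    ext h
    simp [instrumentalCone, ShannonInequalities]
  rw [this]
  refine ((isClosed_iInter fun S => isClosed_le continuous_const (hc S)).inter
    ((isClosed_iInter fun S => isClosed_iInter fun T =>
      isClosed_le continuous_const ((hc _).sub (hc _))).inter
    (isClosed_iInter fun S => isClosed_iInter fun T => isClosed_iInter fun U =>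
      isClosed_le ((hc _).add (hc _)) ((hc _).add (hc _))))).inter (isClosed_le ?_ (hc _))
  exact ((hc _).add (hc _)).sub (hc _)

/-! ### Deterministic strategies with shared randomness -/

section Entropy

open scoped Classical

variable {Ω Ω' : Type*} [Fintype Ω] [Fintype Ω'] {K K' : Type*}

theorem mass_comp_equiv (P : Ω → ℝ) (k : Ω → K) (e : Ω' ≃ Ω) (x : Ω') :
    mass (P ∘ e) (k ∘ e) x = mass P k (e x) :=
  e.sum_comp (fun y => if k y = k (e x) then P y else 0)

theorem rvEntropy_comp_equiv (P : Ω → ℝ) (k : Ω → K) (e : Ω' ≃ Ω) :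
    rvEntropy (P ∘ e) (k ∘ e) = rvEntropy P k := by
  simp only [rvEntropy, mass_comp_equiv]
  rw [neg_inj]
  exact e.sum_comp (fun x => P x * Real.logb 2 (mass P k x))

theorem mass_prod (P : Ω → ℝ) (P' : Ω' → ℝ) (k : Ω → K) (k' : Ω' → K') (x : Ω × Ω') :
    mass (fun x : Ω × Ω' => P x.1 * P' x.2) (fun x => (k x.1, k' x.2)) x =
      mass P k x.1 * mass P' k' x.2 := by
  simp only [mass, Finset.sum_mul_sum, Fintype.sum_prod_type, Prod.mk.injEq]
  refine Finset.sum_congr rfl fun y _ => Finset.sum_congr rfl fun z _ => ?_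
  by_cases h : k y = k x.1 <;> by_cases h' : k' z = k' x.2 <;> simp [h, h']

theorem rvEntropy_prod {P : Ω → ℝ} {P' : Ω' → ℝ} (hP : IsDistribution P)
    (hP' : IsDistribution P') (k : Ω → K) (k' : Ω' → K') :
    rvEntropy (fun x : Ω × Ω' => P x.1 * P' x.2) (fun x => (k x.1, k' x.2)) =
      rvEntropy P k + rvEntropy P' k' := by
  have h : ∀ x : Ω × Ω', P x.1 * P' x.2 * Real.logb 2 (mass P k x.1 * mass P' k' x.2) =
      P x.1 * Real.logb 2 (mass P k x.1) * P' x.2 +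
        P x.1 * (P' x.2 * Real.logb 2 (mass P' k' x.2)) := by
    intro x
    rcases (hP.1 x.1).eq_or_lt with hx | hx
    · simp [← hx]
    rcases (hP'.1 x.2).eq_or_lt with hx' | hx'
    · simp [← hx']
    rw [Real.logb_mul (mass_pos hP.1 k hx).ne' (mass_pos hP'.1 k' hx').ne']
    ring
  simp only [rvEntropy, mass_prod, h, Finset.sum_add_distrib, Fintype.sum_prod_type]
  simp only [← Finset.mul_sum, ← Finset.sum_mul, hP.2, hP'.2]
  ring

/-- Chain rule for a flag that `k'` reveals: level sets have mass `1 - ε`, or `ε` times their mass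
under `μ`. `Real.binEntropy` is in nats, hence the division by `log 2`. -/
theorem rvEntropy_flag {U A : Type*} [Fintype U] [Fintype A] {ε : ℝ} (hε : 0 ≤ ε) {q : A → ℝ}
    (hq : IsDistribution q) {μ : U × A → ℝ} (hμ : IsDistribution μ) {k : U × A → K}
    {W : Option U × A → ℝ} {k' : Option U × A → K'} (hwn : ∀ a, W (none, a) = (1 - ε) * q a)
    (hws : ∀ u a, W (some u, a) = ε * μ (u, a)) (hnn : ∀ a b, k' (none, a) = k' (none, b))
    (hsn : ∀ u a b, k' (some u, a) ≠ k' (none, b))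
    (hss : ∀ u a u' a', k' (some u, a) = k' (some u', a') ↔ k (u, a) = k (u', a')) :
    rvEntropy W k' = ε * rvEntropy μ k + Real.binEntropy ε / Real.log 2 := by
  have hsum : ∀ F : Option U × A → ℝ, ∑ ω, F ω =
      ∑ a : A, F (none, a) + ∑ ω : U × A, F (some ω.1, ω.2) := by
    intro F
    rw [Fintype.sum_prod_type, Fintype.sum_prod_type]
    exact Fintype.sum_option _
  have hmn : ∀ a : A, mass W k' (none, a) = 1 - ε := by
    intro a
    rw [mass, hsum]
    simp [hnn _ a, hsn, hwn, ← Finset.mul_sum, hq.2]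
  have hms : ∀ ω : U × A, mass W k' (some ω.1, ω.2) = ε * mass μ k ω := by
    intro ω
    rw [mass, hsum, mass, Finset.mul_sum]
    simp [fun a => (hsn ω.1 ω.2 a).symm, hss, hws]
  have hlog : ∀ ω : U × A, ε * μ ω * Real.logb 2 (ε * mass μ k ω) =
      ε * Real.logb 2 ε * μ ω + ε * (μ ω * Real.logb 2 (mass μ k ω)) := by
    intro ω
    rcases hε.eq_or_lt with h | h
    · simp [← h]
    rcases (hμ.1 ω).eq_or_lt with hω | hω
    · simp [← hω]
    rw [Real.logb_mul h.ne' (mass_pos hμ.1 _ hω).ne']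
    ring
  rw [rvEntropy, hsum]
  simp only [hmn, hms, hwn, hws, hlog, Finset.sum_add_distrib]
  simp only [← Finset.mul_sum, ← Finset.sum_mul, hμ.2, hq.2, rvEntropy, Real.binEntropy,
    Real.log_inv]
  simp only [Real.logb]
  ring

end Entropy

theorem IsDistribution.prod {ι κ : Type*} [Fintype ι] [Fintype κ] {p : ι → ℝ} {q : κ → ℝ}
    (hp : IsDistribution p) (hq : IsDistribution q) :
    IsDistribution (fun x : ι × κ => p x.1 * q x.2) := by
  refine ⟨fun x => mul_nonneg (hp.1 _) (hq.1 _), ?_⟩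
  simp only [Fintype.sum_prod_type, ← Finset.mul_sum, hq.2, mul_one, hp.2]

/-- A strategy in which `X` is a function `ξ` of local randomness with distribution `u`, and `Z`
and `Y` are obtained by functions `f` and `g` from their observed cause and shared randomness with
distribution `q`. -/
structure SharedStrategy where
  α : Obs → Type
  U : Type
  A : Type
  [fintypeObs : ∀ o, Fintype (α o)]
  [fintypeU : Fintype U]
  [fintypeA : Fintype A]
  u : U → ℝ
  q : A → ℝ
  u_dist : IsDistribution u
  q_dist : IsDistribution q
  ξ : U → α Obs.X
  f : α Obs.X → A → α Obs.Z
  g : α Obs.Z → A → α Obs.Y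

namespace SharedStrategy

attribute [instance] fintypeObs fintypeU fintypeA

variable (M : SharedStrategy)

/-- The observed variables as functions of the randomness. -/
def out (ω : M.U × M.A) : ∀ o, M.α o
  | Obs.X => M.ξ ω.1
  | Obs.Y => M.g (M.f (M.ξ ω.1) ω.2) ω.2
  | Obs.Z => M.f (M.ξ ω.1) ω.2

/-- The distribution of the randomness. -/
def weight (ω : M.U × M.A) : ℝ := M.u ω.1 * M.q ω.2

theorem weight_dist : IsDistribution M.weight := M.u_dist.prod M.q_dist

/-- The distribution of the observed variables. -/
noncomputable def joint : (∀ o, M.α o) → ℝ := pushforward M.weight M.out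

/-- The entropy of the observed variables in `S`. -/
noncomputable def H (S : Finset Obs) : ℝ := rvEntropy M.weight (fun ω (o : S) => M.out ω o)

theorem entropyVector_joint : entropyVector M.joint = fun S => M.H S.1 :=
  funext fun S => shannonEntropy_pushforward _ _ S.1

open Classical in
/-- The distribution of `X`. -/
noncomputable def inputDist (x : M.α Obs.X) : ℝ := ∑ u, if M.ξ u = x then M.u u else 0

theorem inputDist_dist : IsDistribution M.inputDist := by
  classical
  refine ⟨fun x => Finset.sum_nonneg fun u _ => ?_, ?_⟩
  · split_ifs
    exacts [M.u_dist.1 u, le_rfl]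
  · simp only [inputDist]
    rw [Finset.sum_comm]
    simpa using M.u_dist.2

open Classical in
theorem joint_eq (w : ∀ o, M.α o) :
    M.joint w = M.inputDist (w Obs.X) * ∑ a, M.q a *
      ((if M.f (w Obs.X) a = w Obs.Z then 1 else 0) *
        (if M.g (w Obs.Z) a = w Obs.Y then 1 else 0)) := by
  rw [joint, pushforward, inputDist, Finset.sum_mul_sum, Fintype.sum_prod_type]
  refine Finset.sum_congr rfl fun u _ => Finset.sum_congr rfl fun a _ => ?_
  have h : M.out (u, a) = w ↔
      M.ξ u = w Obs.X ∧ M.f (w Obs.X) a = w Obs.Z ∧ M.g (w Obs.Z) a = w Obs.Y := by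
    constructor
    · rintro rfl
      exact ⟨rfl, rfl, rfl⟩
    · rintro ⟨h₁, h₂, h₃⟩
      funext o
      cases o <;> simp only [out, h₁, h₂, h₃]
  by_cases h₁ : M.ξ u = w Obs.X <;> by_cases h₂ : M.f (w Obs.X) a = w Obs.Z <;>
    by_cases h₃ : M.g (w Obs.Z) a = w Obs.Y <;> simp [h, h₁, h₂, h₃, weight]

theorem classicalCompatible : ClassicalCompatible M.joint := by
  classical
  let e := (Fintype.equivFin M.A).symm
  -- Both subsystems carry a copy of the shared randomness.
  refine ⟨M.inputDist, _, _, fun c => if c.1 = c.2 then M.q (e c.1) else 0,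
    fun x a z => if M.f x (e a) = z then 1 else 0,
    fun z b y => if M.g z (e b) = y then 1 else 0, M.inputDist_dist, ⟨fun c => ?_, ?_⟩,
    fun x a => ⟨fun z => ?_, by simp⟩, fun z b => ⟨fun y => ?_, by simp⟩, fun w => ?_⟩
  · dsimp only
    split_ifs
    exacts [M.q_dist.1 _, le_rfl]
  · simp only [Fintype.sum_prod_type, Finset.sum_ite_eq, Finset.mem_univ, if_true]
    rw [e.sum_comp M.q, M.q_dist.2]
  · dsimp only; split_ifs <;> norm_num
  · dsimp only; split_ifs <;> norm_num
  · rw [joint_eq, ← e.sum_comp]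
    simp only [ite_mul, zero_mul, Finset.sum_ite_eq, Finset.mem_univ, if_true]
    congr 1
    refine Finset.sum_congr rfl fun a _ => ?_
    by_cases h₂ : M.f (w Obs.X) (e a) = w Obs.Z <;> simp [h₂]

/-- The resource is the mixture, with weights `q`, of products of two equal distinguishable states.
Coarse-graining the distinguishing measurement along `f x` or `g z` computes the responses. -/
theorem gptCompatible (G : GPT.{u, v}) : GPTCompatible G M.joint := by
  classical
  let i := Fintype.equivFin M.A
  have hpos : 0 < Fintype.card M.A := by
    rw [Fintype.card_pos_iff]
    by_contra h
    rw [not_nonempty_iff] at h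
    simpa using M.q_dist.2
  obtain ⟨A, s, e, hs, he, hes⟩ := G.classical _ hpos
  have hcoarse : ∀ {κ : Type} [Fintype κ] (F : M.A → κ),
      G.IsMeas A (fun k => ∑ j ∈ Finset.univ.filter (fun j => F (i.symm j) = k), e j) := by
    intro κ _ F
    convert G.meas_coarse A e (fun j => F (i.symm j)) he
  have hval : ∀ {κ : Type} [Fintype κ] (F : M.A → κ) (k : κ) (a : M.A),
      (∑ j ∈ Finset.univ.filter (fun j => F (i.symm j) = k), e j) (s (i a)) =
        if F a = k then 1 else 0 := by
    intro κ _ F k a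
    simp [LinearMap.sum_apply, hes, Finset.sum_ite_eq']
  refine ⟨M.inputDist, A, A, ∑ a, M.q a • G.tens A A (s (i a)) (s (i a)), _, _,
    M.inputDist_dist, ?_, fun x => hcoarse (M.f x), fun z => hcoarse (M.g z), fun w => ?_⟩
  · exact (G.state_convex _).sum_mem (fun a _ => M.q_dist.1 a) M.q_dist.2
      fun a _ => G.tens_state _ _ _ (hs _) _ (hs _)
  · rw [joint_eq, map_sum]
    congr 1
    refine Finset.sum_congr rfl fun a _ => ?_
    rw [map_smul, smul_eq_mul, G.effTens_tens A A _ (G.meas_effect _ _ (hcoarse (M.f _)) _) _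
      (G.meas_effect _ _ (hcoarse (M.g _)) _) _ (hs _) _ (hs _), hval, hval]

/-- Two independent strategies. -/
def prod (N : SharedStrategy) : SharedStrategy where
  α o := M.α o × N.α o
  U := M.U × N.U
  A := M.A × N.A
  u c := M.u c.1 * N.u c.2
  q c := M.q c.1 * N.q c.2
  u_dist := M.u_dist.prod N.u_dist
  q_dist := M.q_dist.prod N.q_dist
  ξ c := (M.ξ c.1, N.ξ c.2)
  f x a := (M.f x.1 a.1, N.f x.2 a.2)
  g z a := (M.g z.1 a.1, N.g z.2 a.2)

theorem H_prod (N : SharedStrategy) (S : Finset Obs) : (M.prod N).H S = M.H S + N.H S := by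
  rw [H, H, H, ← rvEntropy_prod M.weight_dist N.weight_dist]
  let e : (M.U × N.U) × (M.A × N.A) ≃ (M.U × M.A) × (N.U × N.A) := Equiv.prodProdProdComm _ _ _ _
  rw [← rvEntropy_comp_equiv _ _ e]
  have hw : (M.prod N).weight =
      (fun x : (M.U × M.A) × (N.U × N.A) => M.weight x.1 * N.weight x.2) ∘ e := by
    funext ω
    exact mul_mul_mul_comm _ _ _ _
  have hout : ∀ ω o, (M.prod N).out ω o = (M.out (e ω).1 o, N.out (e ω).2 o) := by
    intro ω o
    cases o <;> rfl
  rw [hw]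
  refine rvEntropy_congr _ fun ω ω' => ?_
  rw [Prod.mk.injEq, funext_iff, funext_iff, funext_iff, ← forall_and]
  exact forall_congr' fun o =>
    (Eq.congr (hout ω o) (hout ω' o)).trans (Iff.of_eq (Prod.mk.injEq ..))

/-- With probability `1 - ε`, all observed variables report that nothing happens, and otherwise the
strategy `M` is carried out. -/
def flag (ε : ℝ) (h₀ : 0 ≤ ε) (h₁ : ε ≤ 1) : SharedStrategy where
  α o := Option (M.α o)
  U := Option M.U
  A := M.A
  u c := c.elim (1 - ε) fun u => ε * M.u u
  q := M.q
  u_dist := by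
    refine ⟨fun c => ?_, ?_⟩
    · cases c
      exacts [sub_nonneg.2 h₁, mul_nonneg h₀ (M.u_dist.1 _)]
    · simp [Fintype.sum_option, ← Finset.mul_sum, M.u_dist.2]
  q_dist := M.q_dist
  ξ c := c.map M.ξ
  f x a := x.map fun x => M.f x a
  g z a := z.map fun z => M.g z a

/-- The value `none` passes from `X` to `Z` to `Y`, so each single variable reveals the flag; the
empty set does not. -/
theorem H_flag {ε : ℝ} (h₀ : 0 ≤ ε) (h₁ : ε ≤ 1) {S : Finset Obs} (hS : S.Nonempty) :
    (M.flag ε h₀ h₁).H S = ε * M.H S + Real.binEntropy ε / Real.log 2 := by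
  obtain ⟨o₀, ho₀⟩ := hS
  set N := M.flag ε h₀ h₁
  have hon : ∀ a o, N.out ((none : Option M.U), a) o = (none : Option (M.α o)) := fun a o => by
    cases o <;> rfl
  have hos : ∀ u a o, N.out (some u, a) o = some (M.out (u, a) o) := fun u a o => by
    cases o <;> rfl
  refine rvEntropy_flag h₀ M.q_dist M.weight_dist (fun _ => rfl) (fun _ _ => mul_assoc _ _ _)
    (fun a b => funext fun o => (hon a o).trans (hon b o).symm)
    (fun u a b h => Option.some_ne_none _
      ((hos u a o₀).symm.trans ((congrFun h ⟨o₀, ho₀⟩).trans (hon b o₀))))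
    (fun u a u' a' => ?_)
  rw [funext_iff, funext_iff]
  exact forall_congr' fun o =>
    (Eq.congr (hos u a o) (hos u' a' o)).trans Option.some_inj

end SharedStrategy

/-! ### The closed convex cone of entropy vectors of shared-randomness strategies -/

open Filter Topology

/-- The entropy vectors of strategies with shared randomness. -/
def sharedEntropyVectors : Set EntropyVector :=
  {h | ∃ M : SharedStrategy, h = fun S => M.H S.1}

theorem sharedEntropyVectors_subset_classical :
    sharedEntropyVectors ⊆ classicalEntropyVectors := by
  rintro _ ⟨M, rfl⟩
  exact ⟨M.α, _, M.joint, M.classicalCompatible, M.entropyVector_joint.symm⟩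

theorem sharedEntropyVectors_subset_gpt (G : GPT.{u, v}) :
    sharedEntropyVectors ⊆ gptEntropyVectors G := by
  rintro _ ⟨M, rfl⟩
  exact ⟨M.α, _, M.joint, M.gptCompatible G, M.entropyVector_joint.symm⟩

theorem add_mem_sharedEntropyVectors {h h' : EntropyVector} (hh : h ∈ sharedEntropyVectors)
    (hh' : h' ∈ sharedEntropyVectors) : h + h' ∈ sharedEntropyVectors := by
  obtain ⟨M, rfl⟩ := hh
  obtain ⟨N, rfl⟩ := hh'
  exact ⟨M.prod N, funext fun S => (M.H_prod N S.1).symm⟩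

theorem succ_smul_mem_sharedEntropyVectors {h : EntropyVector} (hh : h ∈ sharedEntropyVectors)
    (n : ℕ) : ((n : ℝ) + 1) • h ∈ sharedEntropyVectors := by
  induction n with
  | zero => simpa using hh
  | succ n ih =>
    convert add_mem_sharedEntropyVectors ih hh using 1
    push_cast
    rw [add_smul _ 1 h, one_smul]

/-- `n + 1` copies run with probability `c / (n + 1)` give `c • h` plus a binary entropy that tends
to 0. -/
theorem smul_mem_closure_sharedEntropyVectors {h : EntropyVector} {c : ℝ} (hc : 0 ≤ c)
    (hh : h ∈ closure sharedEntropyVectors) : c • h ∈ closure sharedEntropyVectors := by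
  rw [← closure_closure (s := sharedEntropyVectors)]
  refine map_mem_closure (continuous_const_smul c) hh fun h hh => ?_
  have hε : Tendsto (fun n : ℕ => c / ((n : ℝ) + 1)) atTop (𝓝 0) := by
    simpa [div_eq_mul_inv] using (tendsto_one_div_add_atTop_nhds_zero_nat (𝕜 := ℝ)).const_mul c
  have hlim : Tendsto (fun n : ℕ => c • h +
      fun _ => Real.binEntropy (c / ((n : ℝ) + 1)) / Real.log 2) atTop (𝓝 (c • h)) := by
    have h0 : Tendsto (fun n : ℕ => Real.binEntropy (c / ((n : ℝ) + 1)) / Real.log 2) atTop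
        (𝓝 0) := by
      simpa using ((Real.binEntropy_continuous.tendsto 0).comp hε).div_const (Real.log 2)
    have h1 : Tendsto (fun n : ℕ => (fun _ : {S : Finset Obs // S.Nonempty} =>
        Real.binEntropy (c / ((n : ℝ) + 1)) / Real.log 2)) atTop (𝓝 0) :=
      tendsto_pi_nhds.2 fun _ => h0
    simpa using h1.const_add (c • h)
  refine mem_closure_of_tendsto hlim ?_
  -- The flag probability is at most 1 only for large `n`.
  filter_upwards [hε.eventually (Iic_mem_nhds one_pos)] with n hn
  obtain ⟨M, hM⟩ := succ_smul_mem_sharedEntropyVectors hh n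
  have hpos : (0 : ℝ) < (n : ℝ) + 1 := by positivity
  refine ⟨M.flag (c / ((n : ℝ) + 1)) (by positivity) hn, funext fun S => ?_⟩
  rw [M.H_flag _ _ S.2, ← congrFun hM S]
  simp only [Pi.add_apply, Pi.smul_apply, smul_eq_mul]
  field_simp

theorem add_mem_closure_sharedEntropyVectors {h h' : EntropyVector}
    (hh : h ∈ closure sharedEntropyVectors) (hh' : h' ∈ closure sharedEntropyVectors) :
    h + h' ∈ closure sharedEntropyVectors :=
  map_mem_closure₂ continuous_add hh hh' fun _ h _ h' => add_mem_sharedEntropyVectors h h'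

/-! ### Strategies for the extremal rays -/

/-- The observed variables when `X` is a function of a bit, and the shared randomness is another
bit. -/
def bitOut (ξ : Bool → Bool) (f : Bool → Bool → Bool) (g : Bool → Bool → Bool × Bool)
    (ω : Bool × Bool) : Obs → Bool × Bool
  | Obs.X => (ξ ω.1, false)
  | Obs.Z => (f (ξ ω.1) ω.2, false)
  | Obs.Y => g (f (ξ ω.1) ω.2) ω.2

theorem isDistribution_bool : IsDistribution fun _ : Bool => (1 / 2 : ℝ) :=
  ⟨fun _ => by norm_num, by norm_num⟩

/-- The strategy with uniform bits whose observed variables are given by `bitOut`. -/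
noncomputable def bitStrategy (ξ : Bool → Bool) (f : Bool → Bool → Bool)
    (g : Bool → Bool → Bool × Bool) : SharedStrategy where
  α _ := Bool × Bool
  U := Bool
  A := Bool
  u _ := 1 / 2
  q _ := 1 / 2
  u_dist := isDistribution_bool
  q_dist := isDistribution_bool
  ξ x := (ξ x, false)
  f x a := (f x.1 a, false)
  g z a := g z.1 a

/-- If every fibre has `4 / 2 ^ r` of the four equally likely points, the variables are uniform on
`2 ^ r` values. This reduces each ray to a decidable count. -/
theorem mem_sharedEntropyVectors_of_bits (ξ : Bool → Bool) (f : Bool → Bool → Bool)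
    (g : Bool → Bool → Bool × Bool) (r : Finset Obs → ℕ)
    (h : ∀ S : Finset Obs, S.Nonempty → ∀ ω : Bool × Bool,
      (Finset.univ.filter fun ω' => ∀ o ∈ S, bitOut ξ f g ω' o = bitOut ξ f g ω o).card *
        2 ^ r S = 4) :
    (fun S => (r S.1 : ℝ)) ∈ sharedEntropyVectors := by
  classical
  refine ⟨bitStrategy ξ f g, funext fun S => ?_⟩
  have hout : ∀ ω o, (bitStrategy ξ f g).out ω o = bitOut ξ f g ω o := fun ω o => by
    cases o <;> rfl
  have hw : ∀ ω, (bitStrategy ξ f g).weight ω = 1 / 4 := fun ω => by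
    change (1 / 2 : ℝ) * (1 / 2) = 1 / 4
    norm_num
  have hmass : ∀ ω, mass (bitStrategy ξ f g).weight
      (fun ω (o : S.1) => (bitStrategy ξ f g).out ω o) ω = (2 ^ r S.1)⁻¹ := by
    intro ω
    have hcard := congrArg (Nat.cast : ℕ → ℝ) (h S.1 S.2 ω)
    push_cast at hcard
    have : mass (bitStrategy ξ f g).weight
        (fun ω (o : S.1) => (bitStrategy ξ f g).out ω o) ω =
        ((Finset.univ.filter fun ω' : Bool × Bool =>
          ∀ o ∈ S.1, bitOut ξ f g ω' o = bitOut ξ f g ω o).card : ℝ) * (1 / 4) := by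
      rw [Finset.card_filter, Nat.cast_sum, Finset.sum_mul]
      refine Finset.sum_congr rfl fun ω' _ => ?_
      rw [hw, Nat.cast_ite, ite_mul, Nat.cast_one, Nat.cast_zero, one_mul, zero_mul]
      by_cases hω : ∀ o ∈ S.1, bitOut ξ f g ω' o = bitOut ξ f g ω o
      · rw [if_pos hω, if_pos (restrict_eq_iff.2 fun o ho => by rw [hout, hout, hω o ho])]
      · rw [if_neg hω, if_neg fun h' => hω fun o ho => by
          rw [← hout, ← hout, restrict_eq_iff.1 h' o ho]]
    rw [this]
    refine eq_inv_of_mul_eq_one_left ?_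
    linarith
  rw [SharedStrategy.H, rvEntropy]
  simp only [hmass, Real.logb_inv, Real.logb_pow, Real.logb_self_eq_one one_lt_two]
  rw [← Finset.sum_mul, (bitStrategy ξ f g).weight_dist.2]
  ring

/-- The vector of the number of the two bits that the variables in `S` determine. -/
def bitVector (b c : Finset Obs → Bool) : EntropyVector :=
  fun S => (((b S.1).toNat + (c S.1).toNat : ℕ) : ℝ)

theorem bitVector_mem (ξ : Bool → Bool) (f : Bool → Bool → Bool) (g : Bool → Bool → Bool × Bool)
    (b c : Finset Obs → Bool) (h : ∀ S : Finset Obs, S.Nonempty → ∀ ω : Bool × Bool,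
      (Finset.univ.filter fun ω' => ∀ o ∈ S, bitOut ξ f g ω' o = bitOut ξ f g ω o).card *
        2 ^ ((b S).toNat + (c S).toNat) = 4) :
    bitVector b c ∈ closure sharedEntropyVectors :=
  subset_closure (mem_sharedEntropyVectors_of_bits ξ f g _ h)

open Obs

theorem ray_X : bitVector (fun S => X ∈ S) (fun _ => false) ∈ closure sharedEntropyVectors :=
  bitVector_mem (fun u => u) (fun _ _ => false) (fun _ _ => (false, false)) _ _ (by decide)

theorem ray_Y : bitVector (fun S => Y ∈ S) (fun _ => false) ∈ closure sharedEntropyVectors :=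
  bitVector_mem (fun _ => false) (fun _ _ => false) (fun _ a => (a, false)) _ _ (by decide)

theorem ray_Z : bitVector (fun S => Z ∈ S) (fun _ => false) ∈ closure sharedEntropyVectors :=
  bitVector_mem (fun _ => false) (fun _ a => a) (fun _ _ => (false, false)) _ _ (by decide)

theorem ray_XZ :
    bitVector (fun S => X ∈ S ∨ Z ∈ S) (fun _ => false) ∈ closure sharedEntropyVectors :=
  bitVector_mem (fun u => u) (fun x _ => x) (fun _ _ => (false, false)) _ _ (by decide)

theorem ray_YZ :
    bitVector (fun S => Y ∈ S ∨ Z ∈ S) (fun _ => false) ∈ closure sharedEntropyVectors :=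
  bitVector_mem (fun _ => false) (fun _ a => a) (fun z _ => (z, false)) _ _ (by decide)

theorem ray_XYZ :
    bitVector (fun S => X ∈ S ∨ Y ∈ S ∨ Z ∈ S) (fun _ => false) ∈ closure sharedEntropyVectors :=
  bitVector_mem (fun u => u) (fun x _ => x) (fun z _ => (z, false)) _ _ (by decide)

theorem ray_xor :
    bitVector (fun S => X ∈ S ∨ Y ∈ S ∨ Z ∈ S) (fun S => 2 ≤ S.card) ∈
      closure sharedEntropyVectors :=
  bitVector_mem (fun u => u) (fun x a => xor x a) (fun _ a => (a, false)) _ _ (by decide)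

/-- One-time pad: `Z` encrypts `X` with the shared bit, hence is independent of `X`, and `Y`
decrypts. -/
theorem ray_XY_add_Z :
    bitVector (fun S => X ∈ S ∨ Y ∈ S) (fun S => Z ∈ S) ∈ closure sharedEntropyVectors :=
  bitVector_mem (fun u => u) (fun x a => xor x a) (fun z a => (xor z a, false)) _ _ (by decide)

/-- Here `Y` keeps both ciphertext and key, so it determines `X` and `Z`. -/
theorem ray_XY_add_YZ :
    bitVector (fun S => X ∈ S ∨ Y ∈ S) (fun S => Y ∈ S ∨ Z ∈ S) ∈ closure sharedEntropyVectors :=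
  bitVector_mem (fun u => u) (fun x a => xor x a) (fun z a => (z, a)) _ _ (by decide)

/-! ### Decomposition of the cone into the nine rays -/

theorem finset_obs_cases : ∀ S : Finset Obs, S.Nonempty →
    S = {X} ∨ S = {Y} ∨ S = {Z} ∨ S = {X, Y} ∨ S = {X, Z} ∨ S = {Y, Z} ∨ S = {X, Y, Z} := by
  decide

/-- The inequalities that define the cone, for the seven components of a vector in it. -/
theorem instrumentalCone_components {h : EntropyVector} (hh : h ∈ instrumentalCone) :
    h.H {Y, Z} ≤ h.H {X, Y, Z} ∧ h.H {X, Z} ≤ h.H {X, Y, Z} ∧ h.H {X, Y} ≤ h.H {X, Y, Z} ∧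
    h.H {X, Y} ≤ h.H {X} + h.H {Y} ∧ h.H {X, Z} ≤ h.H {X} + h.H {Z} ∧
    h.H {Y, Z} ≤ h.H {Y} + h.H {Z} ∧
    h.H {X, Y, Z} + h.H {Z} ≤ h.H {X, Z} + h.H {Y, Z} ∧
    h.H {X, Y, Z} + h.H {Y} ≤ h.H {X, Y} + h.H {Y, Z} ∧
    h.H {X, Y, Z} + h.H {X} ≤ h.H {X, Y} + h.H {X, Z} ∧
    h.H {X} + h.H {Y, Z} - h.H {X, Y, Z} ≤ h.H {Z} := by
  obtain ⟨⟨-, hmono, hsub⟩, hI⟩ := hh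
  have h0 : h.H ∅ = 0 := by simp [EntropyVector.H]
  have hm : ∀ S T R : Finset Obs, S ∪ T = R → h.H T ≤ h.H R := by
    rintro S T R rfl
    linarith [hmono S T]
  have hs : ∀ S T U R₁ R₂ R₃ : Finset Obs, S ∪ T ∪ U = R₁ → S ∪ U = R₂ → T ∪ U = R₃ →
      h.H R₁ + h.H U ≤ h.H R₂ + h.H R₃ := by
    rintro S T U R₁ R₂ R₃ rfl rfl rfl
    exact hsub S T U
  refine ⟨hm {X} _ _ (by decide), hm {Y} _ _ (by decide), hm {Z} _ _ (by decide), ?_, ?_, ?_,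
    hs {X} {Y} _ _ _ _ (by decide) (by decide) (by decide),
    hs {X} {Z} _ _ _ _ (by decide) (by decide) (by decide), ?_, hI⟩
  · linarith [hs {X} {Y} ∅ {X, Y} _ _ (by decide) rfl rfl,
      show h.H ({X} ∪ ∅) = h.H {X} from rfl, show h.H ({Y} ∪ ∅) = h.H {Y} from rfl]
  · linarith [hs {X} {Z} ∅ {X, Z} _ _ (by decide) rfl rfl,
      show h.H ({X} ∪ ∅) = h.H {X} from rfl, show h.H ({Z} ∪ ∅) = h.H {Z} from rfl]
  · linarith [hs {Y} {Z} ∅ {Y, Z} _ _ (by decide) rfl rfl,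
      show h.H ({Y} ∪ ∅) = h.H {Y} from rfl, show h.H ({Z} ∪ ∅) = h.H {Z} from rfl]
  · linarith [hs {Y} {Z} {X} {X, Y, Z} {X, Y} {X, Z} (by decide) (by decide) (by decide)]

/-- The conical combinations of the extremal rays are limits of entropy vectors. -/
theorem combination_mem_closure {h : EntropyVector} {x y z xz yz xyz xor s t : ℝ}
    (hx : 0 ≤ x) (hy : 0 ≤ y) (hz : 0 ≤ z) (hxz : 0 ≤ xz) (hyz : 0 ≤ yz) (hxyz : 0 ≤ xyz)
    (hxor : 0 ≤ xor) (hs : 0 ≤ s) (ht : 0 ≤ t)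
    (h₁ : h.H {X} = x + xz + xyz + xor + s + t)
    (h₂ : h.H {Y} = y + yz + xyz + xor + s + 2 * t)
    (h₃ : h.H {Z} = z + xz + yz + xyz + xor + s + t)
    (h₄ : h.H {X, Y} = x + y + xz + yz + xyz + 2 * xor + s + 2 * t)
    (h₅ : h.H {X, Z} = x + z + xz + yz + xyz + 2 * xor + 2 * s + 2 * t)
    (h₆ : h.H {Y, Z} = y + z + xz + yz + xyz + 2 * xor + 2 * s + 2 * t)
    (h₇ : h.H {X, Y, Z} = x + y + z + xz + yz + xyz + 2 * xor + 2 * s + 2 * t) :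
    h ∈ closure sharedEntropyVectors := by
  have hadd {a b : EntropyVector} := @add_mem_closure_sharedEntropyVectors a b
  have hmul {c : ℝ} {a : EntropyVector} := @smul_mem_closure_sharedEntropyVectors a c
  have hmem := hadd (hmul hx ray_X) <| hadd (hmul hy ray_Y) <| hadd (hmul hz ray_Z) <|
    hadd (hmul hxz ray_XZ) <| hadd (hmul hyz ray_YZ) <| hadd (hmul hxyz ray_XYZ) <|
    hadd (hmul hxor ray_xor) <| hadd (hmul hs ray_XY_add_Z) (hmul ht ray_XY_add_YZ)
  convert hmem using 1
  funext ⟨S, hS⟩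
  have hH : h ⟨S, hS⟩ = h.H S := by rw [EntropyVector.H, dif_pos hS]
  rw [hH]
  simp only [Pi.add_apply, Pi.smul_apply, smul_eq_mul, bitVector]
  rcases finset_obs_cases S hS with rfl | rfl | rfl | rfl | rfl | rfl | rfl
  · rw [h₁]; simp; ring
  · rw [h₂]; simp; ring
  · rw [h₃]; simp; ring
  · rw [h₄]; simp; ring
  · rw [h₅]; simp; ring
  · rw [h₆]; simp; ring
  · rw [h₇]; simp; ring

/-- The amount of XY bits in the Shannon decomposition is the smaller of `I(X:Y)` and `I(X:Y|Z)`.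
They are paired with the private bits of `Z`, of amount `H(Z|XY)`, and any excess with YZ bits. -/
theorem instrumentalCone_subset_closure : instrumentalCone ⊆ closure sharedEntropyVectors := by
  intro h hh
  obtain ⟨i₁, i₂, i₃, i₄, i₅, i₆, i₇, i₈, i₉, i₁₀⟩ := instrumentalCone_components hh
  set hX := h.H {X}
  set hY := h.H {Y}
  set hZ := h.H {Z}
  set hXY := h.H {X, Y}
  set hXZ := h.H {X, Z}
  set hYZ := h.H {Y, Z}
  set hXYZ := h.H {X, Y, Z}
  -- The sign of `I(X:Y) - I(X:Y|Z)` decides between the xor vector and the XYZ bit.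
  rcases le_total (hX + hY + hZ + hXYZ) (hXY + hXZ + hYZ) with hI | hI
  · rcases le_total (hX + hY - hXY) (hXYZ - hXY) with hc | hc
    · refine combination_mem_closure (x := hXYZ - hYZ) (y := hXYZ - hXZ)
        (z := hXYZ - hXY - (hX + hY - hXY)) (xz := hX + hZ - hXZ) (yz := hY + hZ - hYZ)
        (xyz := 0) (xor := hXY + hXZ + hYZ - hX - hY - hZ - hXYZ) (s := hX + hY - hXY) (t := 0)
        ?_ ?_ ?_ ?_ ?_ ?_ ?_ ?_ ?_ ?_ ?_ ?_ ?_ ?_ ?_ ?_ <;> linarith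
    -- The private bits of `Z` are used up. The remaining weight `yz` equals `H(Z) - I(X:YZ)`, here
    -- and in the last case; only its sign needs the instrumental inequality.
    · refine combination_mem_closure (x := hXYZ - hYZ) (y := hXYZ - hXZ)
        (z := 0) (xz := hX + hZ - hXZ)
        (yz := hY + hZ - hYZ - (hX + hY - hXY - (hXYZ - hXY)))
        (xyz := 0) (xor := hXY + hXZ + hYZ - hX - hY - hZ - hXYZ) (s := hXYZ - hXY)
        (t := hX + hY - hXY - (hXYZ - hXY))
        ?_ ?_ ?_ ?_ ?_ ?_ ?_ ?_ ?_ ?_ ?_ ?_ ?_ ?_ ?_ ?_ <;> linarith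
  · rcases le_total (hXZ + hYZ - hXYZ - hZ) (hXYZ - hXY) with hc | hc
    · refine combination_mem_closure (x := hXYZ - hYZ) (y := hXYZ - hXZ)
        (z := hXYZ - hXY - (hXZ + hYZ - hXYZ - hZ)) (xz := hXY + hYZ - hXYZ - hY)
        (yz := hXY + hXZ - hXYZ - hX) (xyz := hX + hY + hZ + hXYZ - (hXY + hXZ + hYZ))
        (xor := 0) (s := hXZ + hYZ - hXYZ - hZ) (t := 0)
        ?_ ?_ ?_ ?_ ?_ ?_ ?_ ?_ ?_ ?_ ?_ ?_ ?_ ?_ ?_ ?_ <;> linarith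
    · refine combination_mem_closure (x := hXYZ - hYZ) (y := hXYZ - hXZ)
        (z := 0) (xz := hXY + hYZ - hXYZ - hY)
        (yz := hXY + hXZ - hXYZ - hX - (hXZ + hYZ - hXYZ - hZ - (hXYZ - hXY)))
        (xyz := hX + hY + hZ + hXYZ - (hXY + hXZ + hYZ))
        (xor := 0) (s := hXYZ - hXY) (t := hXZ + hYZ - hXYZ - hZ - (hXYZ - hXY))
        ?_ ?_ ?_ ?_ ?_ ?_ ?_ ?_ ?_ ?_ ?_ ?_ ?_ ?_ ?_ ?_ <;> linarith

theorem closure_eq_instrumentalCone {E : Set EntropyVector} (h : sharedEntropyVectors ⊆ E)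
    (h' : E ⊆ instrumentalCone) : closure E = instrumentalCone :=
  (closure_minimal h' isClosed_instrumentalCone).antisymm
    (instrumentalCone_subset_closure.trans (closure_mono h))

theorem mainTheorem11 :
    closure classicalEntropyVectors = instrumentalCone ∧
    closure quantumEntropyVectors = instrumentalCone ∧
    ∀ G : GPT.{u, v}, closure (gptEntropyVectors G) = instrumentalCone := by
  have hC := sharedEntropyVectors_subset_classical
  have hQ := classicalEntropyVectors_subset_quantum
  exact ⟨closure_eq_instrumentalCone hC (hQ.trans quantumEntropyVectors_subset),
    closure_eq_instrumentalCone (hC.trans hQ) quantumEntropyVectors_subset,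
    fun G => closure_eq_instrumentalCone (sharedEntropyVectors_subset_gpt G)
      (gptEntropyVectors_subset G)⟩
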